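/- Regard $\mathbb{S}^2\times\mathbb{R}$, with its product metric, as $\{(x_1,x_2,x_3,z)\in\mathbb{R}^4 : x_1^2+x_2^2+x_3^2=1\}$, and let $\partial_z$ be the unit vertical field. Let $\mathcal{H}\in C^1([-1,1])$. An $\mathcal{H}$-sphere is a $C^2$ immersion $f:\Sigma\to\mathbb{S}^2\times\mathbb{R}$ (not necessarily injective, not necessarily rotational) of a closed surface $\Sigma$ of genus zero, together with a continuous unit normal field $\eta$ along $f$ tangent to $\mathbb{S}^2\times\mathbb{R}$, such that the mean curvature $H_\Sigma$ of $f$ with respect to $\eta$ (half of the trace of the second fundamental form) satisfies $H_\Sigma(p)=\mathcal{H}(\langle\eta_p,\partial_z\rangle)$ for all $p\in\Sigma$. A zero $z_0\in[-1,1]$ of $\mathcal{H}$ has multiplicity $m\ge 1$ if $\mathcal{H}(y)=(y-z_0)^m g(y)$ on $[-1,1]$ with $g$ continuous and $g(z_0)\ne 0$. Assume that $\mathcal{H}$ has finitely many zeros $z_1,\dots,z_n$ in $[-1,1]$, each of finite multiplicity $m(z_i)$. If there exists an $\mathcal{H}$-sphere in $\mathbb{S}^2\times\mathbb{R}$ that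 is not a horizontal slice $\mathbb{S}^2\times\{t_0\}$ (that is, whose height function is not constant), then $\sum_{i=1}^n m(z_i)$ is even. -/

import Mathlib

open scoped Manifold ContDiff

noncomputable section

/-- The product `𝕊² × ℝ`, realised in `ℝ⁴ = ℝ³ × ℝ`; its Riemannian product metric is the one induced
from `ℝ⁴`. The last coordinate `x 3` is the height, so that `∂_z` is the last basis vector. -/
def sphereProdLine : Set (EuclideanSpace ℝ (Fin 4)) :=
  {x | x 0 ^ 2 + x 1 ^ 2 + x 2 ^ 2 = 1}

/-- The unit normal of `𝕊² × ℝ` in `ℝ⁴` at `x`. A vector is tangent to `𝕊² × ℝ` at `x` iff it is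
orthogonal to `ambientNormal x`. -/
def ambientNormal (x : EuclideanSpace ℝ (Fin 4)) : EuclideanSpace ℝ (Fin 4) :=
  !₂[x 0, x 1, x 2, 0]

/-- The partial derivative `∂ᵢ X` of a map defined on (an open part of) `ℝ²`. -/
def partialDeriv (X : EuclideanSpace ℝ (Fin 2) → EuclideanSpace ℝ (Fin 4)) (i : Fin 2)
    (u : EuclideanSpace ℝ (Fin 2)) : EuclideanSpace ℝ (Fin 4) :=
  fderiv ℝ X u (EuclideanSpace.single i 1)

/-- The first fundamental form `gᵢⱼ = ⟨∂ᵢX, ∂ⱼX⟩` of a parametrized surface. -/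
def firstForm (X : EuclideanSpace ℝ (Fin 2) → EuclideanSpace ℝ (Fin 4))
    (u : EuclideanSpace ℝ (Fin 2)) : Matrix (Fin 2) (Fin 2) ℝ :=
  Matrix.of fun i j => inner ℝ (partialDeriv X i u) (partialDeriv X j u)

/-- The second fundamental form `hᵢⱼ = ⟨∂ᵢ∂ⱼX, N⟩` of a parametrized surface of `𝕊² × ℝ` with respect to
the unit normal `N`. Since `N` is tangent to `𝕊² × ℝ`, the flat derivative `∂ᵢ∂ⱼX` and its projection to
`T(𝕊² × ℝ)`, the covariant derivative of the product, have the same inner product with `N`. -/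
def secondForm (X : EuclideanSpace ℝ (Fin 2) → EuclideanSpace ℝ (Fin 4))
    (N : EuclideanSpace ℝ (Fin 4)) (u : EuclideanSpace ℝ (Fin 2)) : Matrix (Fin 2) (Fin 2) ℝ :=
  Matrix.of fun i j => inner ℝ (partialDeriv (partialDeriv X j) i u) N

/-- The mean curvature: half of the trace of `g⁻¹ h`. -/
def meanCurvature (X : EuclideanSpace ℝ (Fin 2) → EuclideanSpace ℝ (Fin 4))
    (N : EuclideanSpace ℝ (Fin 4)) (u : EuclideanSpace ℝ (Fin 2)) : ℝ :=
  ((firstForm X u)⁻¹ * secondForm X N u).trace / 2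

/-- `f : M → 𝕊² × ℝ` is a `C²` immersion of the surface `M`, oriented by the unit normal field `η`, whose
mean curvature is `H(ν)`, where `ν = ⟨η, ∂_z⟩` is the angle function. The mean curvature is computed in
local coordinates (its value does not depend on the coordinates). -/
structure IsPrescribedMeanCurvatureSurface {M : Type*} [TopologicalSpace M]
    [ChartedSpace (EuclideanSpace ℝ (Fin 2)) M] (H : ℝ → ℝ)
    (f η : M → EuclideanSpace ℝ (Fin 4)) : Prop where
  contMDiff : ContMDiff (𝓡 2) 𝓘(ℝ, EuclideanSpace ℝ (Fin 4)) 2 f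
  injective_mfderiv : ∀ p : M,
    Function.Injective (mfderiv (𝓡 2) 𝓘(ℝ, EuclideanSpace ℝ (Fin 4)) f p)
  mem_sphereProdLine : ∀ p : M, f p ∈ sphereProdLine
  continuous_normal : Continuous η
  norm_normal : ∀ p : M, ‖η p‖ = 1
  normal_tangent_ambient : ∀ p : M, inner ℝ (η p) (ambientNormal (f p)) = 0
  normal_orthogonal : ∀ (p : M) (v : TangentSpace (𝓡 2) p),
    inner ℝ (η p) (mfderiv (𝓡 2) 𝓘(ℝ, EuclideanSpace ℝ (Fin 4)) f p v : EuclideanSpace ℝ (Fin 4)) = 0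
  meanCurvature_eq : ∀ φ ∈ IsManifold.maximalAtlas (𝓡 2) 2 M, ∀ p ∈ φ.source,
    meanCurvature (f ∘ φ.symm) (η p) (φ p) = H (η p 3)

/-- `z ∈ [-1,1]` is a zero of `H` of multiplicity `m`: `m ≥ 1` and `H(y) = (y - z)^m g(y)` on `[-1,1]`
with `g` continuous and `g(z) ≠ 0`. -/
def IsZeroOfMultiplicity (H : ℝ → ℝ) (z : ℝ) (m : ℕ) : Prop :=
  1 ≤ m ∧ ∃ g : ℝ → ℝ, ContinuousOn g (Set.Icc (-1) 1) ∧ g z ≠ 0 ∧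
    ∀ y ∈ Set.Icc (-1 : ℝ) 1, H y = (y - z) ^ m * g y

end

/-!
Let `ν` be the angle function and `h` the height of the surface. Since `∂_z` is parallel, `Δh = 2 H(ν) ν` and
`1 - ν² = |∇h|²`. At a highest point the normal is `a ∂_z` with `a = ±1`, and `Δh ≤ 0` gives `a H(a) ≤ 0`; at
a lowest point the normal is `b ∂_z` with `b = ±1`, and `b H(b) ≥ 0`.

Both inequalities are strict. If, say, `H(a) = 0`, then the horizontal slice with normal `a ∂_z` is itself a
surface of prescribed mean curvature `H(ν)`, tangent to the given one at its highest point and lying on one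
side of it. As `H` vanishes at least to first order at `a`, near that point
`|H(ν)| ≤ L (1 - aν) ≤ L (1 - ν²) = L |∇h|²`, so that `h` satisfies a homogeneous linear elliptic inequality
with locally bounded coefficients. Hopf's strong maximum principle
(`eventually_eq_zero_of_nonpos_of_elliptic`) makes `h` constant near the highest point, hence everywhere by
connectedness (`IsPrescribedMeanCurvatureSurface.height_eq_of_isZeroOfMultiplicity`), which is excluded.

Thus `a H(a) < 0 < b H(b)`, which forces `b = -a` and makes `H(1)` and `H(-1)` nonzero and of the same sign. A
function changes sign exactly at its zeros of odd multiplicity, so the sum of the multiplicities is even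
(`neg_one_pow_sum_multiplicity_mul_pos`). Of the genus, only compactness and connectedness are used.

The equations are used in local coordinates, where `g` and `h` with indices are the first and second
fundamental forms. They are multiplied by powers of `det g`, and the principal part of the Laplacian is written
as a sum of squares `∑ D²h(eᵢ, eᵢ)` with explicit vector fields (`ellipticFrame`).
-/

open Filter Topology

/-! ### The strong maximum principle -/

/-- The second order necessary condition for a local maximum. -/
lemma IsLocalMax.fderiv_fderiv_nonpos {E : Type*} [NormedAddCommGroup E] [NormedSpace ℝ E]
    {F : E → ℝ} {x : E} (h : IsLocalMax F x) (hF : ContDiffAt ℝ 2 F x) (e : E) :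
    fderiv ℝ (fderiv ℝ F) x e e ≤ 0 := by
  by_contra! hpos
  set l : ℝ → E := fun t => x + t • e with hl
  have hl0 : l 0 = x := by simp [hl]
  have hld : ∀ t, HasDerivAt l e t := fun t => by
    simpa [hl] using ((hasDerivAt_id t).smul_const e).const_add x
  have hlc : Tendsto l (𝓝 0) (𝓝 x) := by
    have := (hld 0).continuousAt.tendsto
    rwa [hl0] at this
  set φ : ℝ → ℝ := F ∘ l with hφ
  have hev : ∀ᶠ y in 𝓝 x, DifferentiableAt ℝ F y :=
    (hF.eventually (by simp)).mono fun y hy => hy.differentiableAt (by simp)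
  have hd1 : deriv φ =ᶠ[𝓝 0] fun t => fderiv ℝ F (l t) e := by
    filter_upwards [hlc.eventually hev] with t ht
    exact (ht.hasFDerivAt.comp_hasDerivAt t (hld t)).deriv
  have hd2 : HasDerivAt (fun t => fderiv ℝ F (l t) e) (fderiv ℝ (fderiv ℝ F) x e e) 0 := by
    have h1 : HasFDerivAt (fderiv ℝ F) (fderiv ℝ (fderiv ℝ F) x) (l 0) := by
      rw [hl0]
      exact ((hF.fderiv_right (m := 1) (by norm_num)).differentiableAt (by simp)).hasFDerivAt
    have h2 := h1.comp_hasDerivAt (0 : ℝ) (hld 0)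
    simpa using h2.clm_apply (hasDerivAt_const (0 : ℝ) e)
  have hdd : deriv (deriv φ) 0 = fderiv ℝ (fderiv ℝ F) x e e := by
    rw [hd1.deriv_eq]; exact hd2.deriv
  have hmax : IsLocalMax φ 0 := by
    have : ∀ᶠ y in 𝓝 x, F y ≤ F x := h
    filter_upwards [hlc.eventually this] with t ht
    simpa [hφ, hl0] using ht
  have hcont : ContinuousAt φ 0 :=
    ContinuousAt.comp (by rw [hl0]; exact hF.continuousAt) (hld 0).continuousAt
  -- If `φ'' 0 > 0`, then `0` is also a local minimum of `φ`, so `φ` is constant near `0`.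
  have hmin : IsLocalMin φ 0 :=
    isLocalMin_of_deriv_deriv_pos (by rw [hdd]; exact hpos) hmax.deriv_eq_zero hcont
  have hconst : φ =ᶠ[𝓝 0] fun _ => φ 0 := by
    filter_upwards [hmax, hmin] with t h1 h2
    exact le_antisymm h1 h2
  have : deriv (deriv φ) 0 = 0 := by
    rw [(hconst.deriv).deriv_eq]; simp
  rw [hdd] at this
  exact hpos.ne' this

section Hopf
variable {E : Type*} [NormedAddCommGroup E] [InnerProductSpace ℝ E]

lemma hasFDerivAt_gaussian (a : ℝ) (c x : E) :
    HasFDerivAt (fun y : E => Real.exp (-a * ‖y - c‖ ^ 2))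
      ((-2 * a * Real.exp (-a * ‖x - c‖ ^ 2)) • innerSL ℝ (x - c)) x := by
  have h1 : HasFDerivAt (fun y : E => ‖y - c‖ ^ 2) (2 • innerSL ℝ (x - c)) x := by
    simpa using ((hasFDerivAt_id x).sub_const c).norm_sq
  convert (h1.const_mul (-a)).exp using 1
  ext v
  simp
  ring

lemma fderiv_fderiv_gaussian (a : ℝ) (c x e : E) :
    fderiv ℝ (fderiv ℝ fun y : E => Real.exp (-a * ‖y - c‖ ^ 2)) x e e =
      Real.exp (-a * ‖x - c‖ ^ 2) * (4 * a ^ 2 * inner ℝ e (x - c) ^ 2 - 2 * a * ‖e‖ ^ 2) := by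
  have h0 : (fderiv ℝ fun y : E => Real.exp (-a * ‖y - c‖ ^ 2)) =
      fun x => (-2 * a * Real.exp (-a * ‖x - c‖ ^ 2)) • innerSL ℝ (x - c) :=
    funext fun x => (hasFDerivAt_gaussian a c x).fderiv
  have h1 : HasFDerivAt (fun x : E => innerSL ℝ (x - c)) (innerSL ℝ : E →L[ℝ] E →L[ℝ] ℝ) x := by
    exact (innerSL ℝ : E →L[ℝ] E →L[ℝ] ℝ).hasFDerivAt.comp x ((hasFDerivAt_id x).sub_const c)
  have h2 := ((hasFDerivAt_gaussian a c x).const_mul (-2 * a)).smul h1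
  rw [h0]
  erw [h2.fderiv]
  have h3 : (innerSL ℝ : E →L[ℝ] E →L[ℝ] ℝ) e e = ‖e‖ ^ 2 := real_inner_self_eq_norm_sq e
  have h4 : (innerSL ℝ : E →L[ℝ] E →L[ℝ] ℝ) (x - c) e = inner ℝ e (x - c) := real_inner_comm _ _
  simp only [add_apply, smul_apply, ContinuousLinearMap.smulRight_apply, smul_eq_mul, h3]
  erw [h4]
  ring

/-- Hopf's strong maximum principle: if `w ≤ 0` satisfies `∑ D²w(eᵢ, eᵢ) ≥ -C ‖∇w‖` for continuous
vector fields `eᵢ` that span the space at every point (so that the left side is a second order elliptic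
operator without lower order terms), and `w` vanishes at `p`, then `w` vanishes near `p`.

Otherwise some ball on which `w < 0` touches the zero set at a single point `y`. With `c` and `r` the centre
and radius of this ball and `a` large, the barrier `v x = exp (-a ‖x - c‖²) - exp (-a r²)` satisfies
`∑ D²v(eᵢ, eᵢ) > C ‖∇v‖` near `y`, and a small multiple of `v` added to `w` produces an interior maximum
near `y`, at which the two inequalities contradict each other. -/
theorem eventually_eq_zero_of_nonpos_of_elliptic [ProperSpace E] {ι : Type*} [Fintype ι]
    {U : Set E} (hU : IsOpen U) {w : E → ℝ} (hw : ContDiffOn ℝ 2 w U)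
    {e : ι → E → E} (he : ∀ i, ContinuousOn (e i) U)
    (hspan : ∀ x ∈ U, ∀ d : E, (∀ i, inner ℝ (e i x) d = 0) → d = 0) {C : ℝ}
    (hineq : ∀ x ∈ U,
      -C * ‖fderiv ℝ w x‖ ≤ ∑ i, fderiv ℝ (fderiv ℝ w) x (e i x) (e i x))
    (hle : ∀ x ∈ U, w x ≤ 0) {p : E} (hp : p ∈ U) (hwp : w p = 0) :
    ∀ᶠ x in 𝓝 p, w x = 0 := by
  obtain ⟨R, hR, hRU⟩ := Metric.nhds_basis_closedBall.mem_iff.1 (hU.mem_nhds hp)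
  have hwU : ContinuousOn w U := hw.continuousOn
  filter_upwards [Metric.ball_mem_nhds p (half_pos hR)] with q hq
  by_contra hq0
  rw [Metric.mem_ball] at hq
  have hqB : q ∈ Metric.closedBall p R := by
    rw [Metric.mem_closedBall]; linarith
  -- `y` is the zero of `w` closest to a point `q` near `p` where `w < 0`.
  set Z : Set E := {x ∈ Metric.closedBall p R | w x = 0} with hZ
  have hZc : IsCompact Z := by
    have : IsClosed Z :=
      (hwU.mono hRU).preimage_isClosed_of_isClosed Metric.isClosed_closedBall isClosed_singleton
    exact (isCompact_closedBall p R).of_isClosed_subset this fun x hx => hx.1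
  have hpZ : p ∈ Z := ⟨Metric.mem_closedBall_self hR.le, hwp⟩
  obtain ⟨y, hyZ, hymin⟩ := hZc.exists_isMinOn ⟨p, hpZ⟩
    (continuous_const.dist continuous_id : Continuous fun x => dist q x).continuousOn
  have hyp : dist q y ≤ dist q p := hymin hpZ
  have hyR : dist y p < R := by
    have := dist_triangle_left y p q
    linarith
  have hyq : y ≠ q := fun h => hq0 (h ▸ hyZ.2)
  have hnear : ∀ x, dist q x < dist q y → w x < 0 := by
    intro x hx
    have hxR : x ∈ Metric.closedBall p R := by
      rw [Metric.mem_closedBall]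
      have := dist_triangle_left x p q
      linarith
    refine lt_of_le_of_ne (hle x (hRU hxR)) fun h0 => ?_
    have : dist q y ≤ dist q x := hymin (show x ∈ Z from ⟨hxR, h0⟩)
    linarith
  -- Half the distance, centred at the midpoint of `q` and `y`: this ball meets the zero set only at `y`.
  set c : E := (1 / 2 : ℝ) • (q + y) with hc
  set r : ℝ := ‖y - c‖ with hr
  have hyc : y - c = (1 / 2 : ℝ) • (y - q) := by rw [hc]; module
  have hr0 : 0 < r := by
    rw [hr, hyc, norm_pos_iff]
    exact smul_ne_zero (by norm_num) (sub_ne_zero.2 hyq)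
  have hqy : dist q y = 2 * r := by
    rw [hr, hyc, norm_smul, dist_comm, dist_eq_norm, Real.norm_of_nonneg (by norm_num)]; ring
  have hball : ∀ x, ‖x - c‖ ≤ r → x ≠ y → w x < 0 := by
    intro x hx hxy
    apply hnear
    have hpar := parallelogram_law_with_norm ℝ (x - c) (y - c)
    have h1 : x - c + (y - c) = x - q := by rw [hc]; module
    have h2 : x - c - (y - c) = x - y := by abel
    rw [h1, h2] at hpar
    have h3 : 0 < ‖x - y‖ := norm_pos_iff.2 (sub_ne_zero.2 hxy)
    rw [hqy, dist_comm, dist_eq_norm]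
    apply lt_of_pow_lt_pow_left₀ 2 (by positivity)
    rw [← hr] at hpar
    nlinarith [norm_nonneg (x - c)]
  -- `ρ < r` keeps `c` out of the ball, where `∇v` would vanish.
  obtain ⟨ρ, hρ0, hρr, hρU⟩ : ∃ ρ > 0, ρ < r ∧ Metric.closedBall y ρ ⊆ U := by
    refine ⟨min (r / 2) (R - dist y p), lt_min (half_pos hr0) (by linarith),
      (min_le_left _ _).trans_lt (half_lt_self hr0), fun x hx => hRU ?_⟩
    rw [Metric.mem_closedBall] at hx ⊢
    have := dist_triangle x y p
    have := min_le_right (r / 2) (R - dist y p)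
    linarith
  have hKc := isCompact_closedBall y ρ
  have hyK : y ∈ Metric.closedBall y ρ := Metric.mem_closedBall_self hρ0.le
  have heK : ∀ i, ContinuousOn (e i) (Metric.closedBall y ρ) := fun i => (he i).mono hρU
  -- `μ` is the ellipticity in the direction `x - c`, and `B` bounds the terms of `∑ D²v(eᵢ, eᵢ) - C ‖∇v‖`
  -- of first order in `a`; the term of second order dominates them when `B < 2 a μ`.
  obtain ⟨μ, hμ0, hμ⟩ : ∃ μ > 0, ∀ x ∈ Metric.closedBall y ρ,
      μ ≤ ∑ i, inner ℝ (e i x) (x - c) ^ 2 := by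
    have hcont : ContinuousOn (fun x => ∑ i, inner ℝ (e i x) (x - c) ^ 2)
        (Metric.closedBall y ρ) :=
      continuousOn_finsetSum _ fun i _ =>
        ((heK i).inner (continuousOn_id.sub continuousOn_const)).pow 2
    obtain ⟨x, hx, hmin⟩ := hKc.exists_isMinOn ⟨y, hyK⟩ hcont
    refine ⟨_, ?_, fun z hz => hmin hz⟩
    refine lt_of_le_of_ne (Finset.sum_nonneg fun i _ => sq_nonneg _) fun h0 => ?_
    have h1 := (Finset.sum_eq_zero_iff_of_nonneg fun i _ => sq_nonneg _).1 h0.symm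
    have h2 := hspan x (hρU hx) (x - c) fun i => by simpa using h1 i (Finset.mem_univ i)
    rw [Metric.mem_closedBall, dist_comm, dist_eq_norm] at hx
    rw [sub_eq_zero] at h2
    rw [h2] at hx
    linarith
  obtain ⟨B, hB⟩ : ∃ B, ∀ x ∈ Metric.closedBall y ρ,
      (∑ i, ‖e i x‖ ^ 2) + C * ‖x - c‖ ≤ B := by
    have hcont : ContinuousOn (fun x => (∑ i, ‖e i x‖ ^ 2) + C * ‖x - c‖)
        (Metric.closedBall y ρ) :=
      (continuousOn_finsetSum _ fun i _ => (heK i).norm.pow 2).add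
        (continuousOn_const.mul (continuousOn_id.sub continuousOn_const).norm)
    obtain ⟨B, hB⟩ := hKc.bddAbove_image hcont
    exact ⟨B, fun x hx => hB ⟨x, hx, rfl⟩⟩
  obtain ⟨a, ha0, ha⟩ : ∃ a > 0, B < 2 * a * μ := by
    refine ⟨(|B| + 1) / (2 * μ), by positivity, ?_⟩
    have : 2 * ((|B| + 1) / (2 * μ)) * μ = |B| + 1 := by field_simp
    rw [this]
    linarith [le_abs_self B]
  set G : E → ℝ := fun x => Real.exp (-a * ‖x - c‖ ^ 2) with hG
  have hGC : ContDiff ℝ 2 G := by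
    have : ContDiff ℝ 2 fun x : E => ‖x - c‖ ^ 2 := (contDiff_id.sub contDiff_const).norm_sq ℝ
    exact Real.contDiff_exp.comp (contDiff_const.mul this)
  -- On the part of the small sphere where `v ≥ 0`, the function `w` is bounded away from `0`.
  obtain ⟨δ, hδ0, hδ⟩ : ∃ δ > 0, ∀ x ∈ Metric.sphere y ρ, ‖x - c‖ ≤ r → w x ≤ -δ := by
    set T : Set E := Metric.sphere y ρ ∩ {x | ‖x - c‖ ≤ r} with hT
    have hTc : IsCompact T := (isCompact_sphere y ρ).inter_right
      (isClosed_le (continuous_id.sub continuous_const).norm continuous_const)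
    rcases T.eq_empty_or_nonempty with h | h
    · exact ⟨1, one_pos, fun x hx hxr => absurd (show x ∈ T from ⟨hx, hxr⟩) (by simp [h])⟩
    · obtain ⟨x, hx, hmax⟩ := hTc.exists_isMaxOn h
        (hwU.mono fun x hx => hρU (Metric.sphere_subset_closedBall hx.1))
      refine ⟨-w x, neg_pos.2 (hball x hx.2 ?_), fun z hz hzr => ?_⟩
      · rintro rfl
        have := hx.1
        rw [Metric.mem_sphere, dist_self] at this
        linarith
      · rw [neg_neg]; exact hmax (show z ∈ T from ⟨hz, hzr⟩)
  -- `F` is `w + (δ / 2) v` up to an additive constant.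
  set F : E → ℝ := fun x => w x + δ / 2 * G x with hF
  obtain ⟨x, hxK, hxmax⟩ := hKc.exists_isMaxOn ⟨y, hyK⟩
    (((hwU.mono hρU).add (continuousOn_const.mul hGC.continuous.continuousOn)) :
      ContinuousOn F (Metric.closedBall y ρ))
  have hGy : ∀ z, r < ‖z - c‖ → G z < G y := by
    intro z hz
    apply Real.exp_lt_exp.2
    have : r ^ 2 < ‖z - c‖ ^ 2 := by gcongr
    rw [← hr]
    nlinarith
  have hFy : δ / 2 * G y ≤ F x := by
    have : F y ≤ F x := hxmax hyK
    simpa [hF, hyZ.2] using this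
  have hxball : x ∈ Metric.ball y ρ := by
    rw [← Metric.ball_union_sphere] at hxK
    refine hxK.resolve_right fun hxS => ?_
    rcases le_or_gt ‖x - c‖ r with h | h
    · have h1 := hδ x hxS h
      have h2 : G x ≤ 1 := by
        rw [hG]; simp only [Real.exp_le_one_iff]
        nlinarith [sq_nonneg ‖x - c‖]
      have h3 : 0 < G y := Real.exp_pos _
      have h4 : F x = w x + δ / 2 * G x := rfl
      nlinarith
    · have h1 := hGy x h
      have h2 := hle x (hρU (Metric.sphere_subset_closedBall hxS))
      have h4 : F x = w x + δ / 2 * G x := rfl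
      nlinarith
  have hloc : IsLocalMax F x :=
    hxmax.isLocalMax (mem_of_superset (Metric.isOpen_ball.mem_nhds hxball)
      Metric.ball_subset_closedBall)
  have hxU : x ∈ U := hρU hxK
  have hwx : ContDiffAt ℝ 2 w x := hw.contDiffAt (hU.mem_nhds hxU)
  have hvx : ContDiffAt ℝ 2 (fun x => δ / 2 * G x) x := (contDiff_const.mul hGC).contDiffAt
  have hFx : ContDiffAt ℝ 2 F x := hwx.add hvx
  have hfd : ∀ᶠ z in 𝓝 x, fderiv ℝ F z = fderiv ℝ w z + (δ / 2) • fderiv ℝ G z := by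
    filter_upwards [hwx.eventually (by simp)] with z hz
    have hGz := (hGC.differentiable (by simp)).differentiableAt (x := z)
    have := (hz.differentiableAt (by simp)).hasFDerivAt.add (hGz.hasFDerivAt.const_mul (δ / 2))
    exact this.fderiv
  have hgrad : fderiv ℝ w x = -((δ / 2) • fderiv ℝ G x) := by
    have h1 := hfd.self_of_nhds
    rw [hloc.fderiv_eq_zero] at h1
    exact eq_neg_of_add_eq_zero_left h1.symm
  have hhess : ∀ v, fderiv ℝ (fderiv ℝ w) x v v ≤ -(δ / 2 * fderiv ℝ (fderiv ℝ G) x v v) := by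
    intro v
    have h1 := hloc.fderiv_fderiv_nonpos hFx v
    have hw1 := ((hwx.fderiv_right (m := 1) (by norm_num)).differentiableAt (by simp)).hasFDerivAt
    have hG1 := ((hGC.contDiffAt.fderiv_right (x₀ := x) (m := 1)
      (by norm_num)).differentiableAt (by simp)).hasFDerivAt
    have h2 : fderiv ℝ (fderiv ℝ F) x =
        fderiv ℝ (fderiv ℝ w) x + (δ / 2) • fderiv ℝ (fderiv ℝ G) x := by
      rw [EventuallyEq.fderiv_eq hfd]
      exact (hw1.add (hG1.const_smul (δ / 2))).fderiv
    rw [h2] at h1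
    simp only [add_apply, smul_apply, smul_eq_mul] at h1
    linarith
  have hnorm : ‖fderiv ℝ w x‖ = δ / 2 * (2 * a * G x * ‖x - c‖) := by
    rw [hgrad, norm_neg, norm_smul, (hasFDerivAt_gaussian a c x).fderiv, norm_smul,
      innerSL_apply_norm, Real.norm_of_nonneg (by positivity)]
    have : ‖-2 * a * Real.exp (-a * ‖x - c‖ ^ 2)‖ = 2 * a * G x := by
      rw [Real.norm_eq_abs, abs_of_nonpos]
      · ring
      · have := Real.exp_pos (-a * ‖x - c‖ ^ 2)
        nlinarith [mul_pos ha0 this]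
    rw [this]
  have hsum : ∑ i, fderiv ℝ (fderiv ℝ w) x (e i x) (e i x) ≤
      -(δ / 2 * (G x * (4 * a ^ 2 * (∑ i, inner ℝ (e i x) (x - c) ^ 2)
        - 2 * a * ∑ i, ‖e i x‖ ^ 2))) := by
    refine (Finset.sum_le_sum fun i _ => hhess (e i x)).trans (le_of_eq ?_)
    rw [Finset.mul_sum, Finset.mul_sum, ← Finset.sum_sub_distrib, Finset.mul_sum,
      Finset.mul_sum, ← Finset.sum_neg_distrib]
    refine Finset.sum_congr rfl fun i _ => ?_
    rw [hG, fderiv_fderiv_gaussian]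
  have hfin := hineq x hxU
  rw [hnorm] at hfin
  have hGx : 0 < G x := Real.exp_pos _
  have h1 := hμ x hxK
  have h2 := hB x hxK
  have h3 : 0 < δ * a * G x := by positivity
  have h4 : 0 < 2 * a * (∑ i, inner ℝ (e i x) (x - c) ^ 2)
      - (∑ i, ‖e i x‖ ^ 2) - C * ‖x - c‖ := by nlinarith
  have h5 := mul_pos h3 h4
  nlinarith

end Hopf

/-! ### Parity of the sum of the multiplicities -/

/-- If a continuous function `H` on `[-1, 1]` has zero set `S` with multiplicities `m`, and does not vanish
at `±1`, then `H (-1)` has the sign of `H 1` times `(-1) ^ ∑ m`. Zeros are divided out one at a time. -/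
theorem neg_one_pow_sum_multiplicity_mul_pos (S : Finset ℝ) :
    ∀ (H : ℝ → ℝ) (m : ℝ → ℕ), ContinuousOn H (Set.Icc (-1) 1) → H 1 ≠ 0 → H (-1) ≠ 0 →
      (∀ z ∈ Set.Icc (-1 : ℝ) 1, H z = 0 ↔ z ∈ S) → (∀ z ∈ S, z ∈ Set.Icc (-1 : ℝ) 1) →
      (∀ z ∈ S, IsZeroOfMultiplicity H z (m z)) →
      0 < (-1) ^ (∑ z ∈ S, m z) * (H 1 * H (-1)) := by
  have h1 : (1 : ℝ) ∈ Set.Icc (-1 : ℝ) 1 := by norm_num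
  have h1' : (-1 : ℝ) ∈ Set.Icc (-1 : ℝ) 1 := by norm_num
  induction S using Finset.induction_on with
  | empty =>
    intro H m hH hp hn hz _ _
    simp only [Finset.sum_empty, pow_zero, one_mul]
    by_contra! hle
    have hlt : H 1 * H (-1) < 0 := lt_of_le_of_ne hle (mul_ne_zero hp hn)
    have hivt : (0 : ℝ) ∈ H '' Set.Icc (-1) 1 := by
      rcases mul_neg_iff.1 hlt with ⟨h, h'⟩ | ⟨h, h'⟩
      · exact intermediate_value_Icc (by norm_num) hH ⟨h'.le, h.le⟩
      · exact intermediate_value_Icc' (by norm_num) hH ⟨h.le, h'.le⟩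
    obtain ⟨z, hzI, hz0⟩ := hivt
    simpa using (hz z hzI).1 hz0
  | insert z S hzS ih =>
    intro H m hH hp hn hz hSI hmult
    obtain ⟨-, g, hg, hgz, hHg⟩ := hmult z (Finset.mem_insert_self z S)
    have hzI := hSI z (Finset.mem_insert_self z S)
    have hz1 : z ≠ 1 := fun h => hp ((hz 1 h1).2 (h ▸ Finset.mem_insert_self z S))
    have hz1' : z ≠ -1 := fun h => hn ((hz (-1) h1').2 (h ▸ Finset.mem_insert_self z S))
    have hH1 := hHg 1 h1
    have hH1' := hHg (-1) h1'
    have hgp : g 1 ≠ 0 := fun h => hp (by rw [hH1, h, mul_zero])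
    have hgn : g (-1) ≠ 0 := fun h => hn (by rw [hH1', h, mul_zero])
    have key := ih g m hg hgp hgn ?_ (fun y hy => hSI y (Finset.mem_insert_of_mem hy)) ?_
    · rw [Finset.sum_insert hzS, hH1, hH1']
      have h2 : 0 < ((-1) * ((1 - z) * (-1 - z))) ^ m z := by
        apply pow_pos
        have := lt_of_le_of_ne hzI.1 (Ne.symm hz1')
        have := lt_of_le_of_ne hzI.2 hz1
        nlinarith
      have := mul_pos h2 key
      rw [mul_pow, mul_pow] at this
      rw [pow_add]
      linarith
    · intro y hy
      by_cases hyz : y = z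
      · subst hyz; exact ⟨fun h => absurd h hgz, fun h => absurd h hzS⟩
      · have h3 := hz y hy
        rw [hHg y hy, Finset.mem_insert, mul_eq_zero] at h3
        have h4 : (y - z) ^ m z ≠ 0 := pow_ne_zero _ (sub_ne_zero.2 hyz)
        simpa [h4, hyz] using h3
    · intro y hy
      have hyz : y ≠ z := fun h => hzS (h ▸ hy)
      obtain ⟨hm, k, hk, hky, hHk⟩ := hmult y (Finset.mem_insert_of_mem hy)
      -- `q` is the continuous extension over `y` of `x ↦ g x / (x - y) ^ m y`: away from `z` it equals the
      -- quotient `k x / (x - z) ^ m z`, which is continuous at `y`.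
      set q : ℝ → ℝ := fun x => if x = z then g x / (x - y) ^ m y else k x / (x - z) ^ m z with hq
      have hqk : ∀ x, x ≠ z → q x = k x / (x - z) ^ m z := fun x hx => by simp [hq, hx]
      have hqg : ∀ x ∈ Set.Icc (-1 : ℝ) 1, x ≠ y → q x = g x / (x - y) ^ m y := by
        intro x hx hxy
        by_cases hxz : x = z
        · simp [hq, hxz]
        · rw [hqk x hxz, div_eq_div_iff (pow_ne_zero _ (sub_ne_zero.2 hxz))
            (pow_ne_zero _ (sub_ne_zero.2 hxy)), mul_comm, ← hHk x hx, hHg x hx, mul_comm]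
      refine ⟨hm, q, ?_, ?_, ?_⟩
      · intro x hx
        by_cases hxy : x = y
        · have hxz : x ≠ z := hxy ▸ hyz
          have hc : ContinuousWithinAt (fun x => k x / (x - z) ^ m z) (Set.Icc (-1) 1) x :=
            (hk x hx).div (((continuous_id.sub continuous_const).pow _).continuousWithinAt)
              (pow_ne_zero _ (sub_ne_zero.2 hxz))
          refine hc.congr_of_eventuallyEq ?_ (hqk x hxz)
          filter_upwards [mem_nhdsWithin_of_mem_nhds (isOpen_ne.mem_nhds hxz)] with t ht
          exact hqk t ht
        · have hc : ContinuousWithinAt (fun x => g x / (x - y) ^ m y) (Set.Icc (-1) 1) x :=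
            (hg x hx).div (((continuous_id.sub continuous_const).pow _).continuousWithinAt)
              (pow_ne_zero _ (sub_ne_zero.2 hxy))
          refine hc.congr_of_eventuallyEq ?_ (hqg x hx hxy)
          filter_upwards [mem_nhdsWithin_of_mem_nhds (isOpen_ne.mem_nhds hxy),
            self_mem_nhdsWithin] with t ht htI
          exact hqg t htI ht
      · rw [hqk y hyz]
        exact div_ne_zero hky (pow_ne_zero _ (sub_ne_zero.2 hyz))
      · intro x hx
        by_cases hxy : x = y
        · have h5 : g x = 0 := by
            have h6 := (hz x hx).2 (hxy ▸ Finset.mem_insert_of_mem hy)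
            rw [hHg x hx] at h6
            exact (mul_eq_zero.1 h6).resolve_left
              (pow_ne_zero _ (sub_ne_zero.2 (hxy ▸ hyz)))
          rw [h5, hxy, sub_self, zero_pow (by omega), zero_mul]
        · rw [hqg x hx hxy]
          field_simp [pow_ne_zero _ (sub_ne_zero.2 hxy)]

/-! ### Local geometry of surfaces in `𝕊² × ℝ` -/

section Algebra

/-- Strict Cauchy–Schwarz: the Gram determinant of a linearly independent pair is positive. -/
lemma gram_det_pos {F : Type*} [NormedAddCommGroup F] [InnerProductSpace ℝ F] {v w : F}
    (h : LinearIndependent ℝ ![v, w]) :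
    0 < inner ℝ v v * inner ℝ w w - inner ℝ v w ^ 2 := by
  have hv : v ≠ 0 := h.ne_zero 0
  have hv0 : 0 < inner ℝ v v := real_inner_self_pos.2 hv
  have hne : (inner ℝ v v : ℝ) • w - (inner ℝ v w : ℝ) • v ≠ 0 := by
    intro h0
    have := (LinearIndependent.pair_iff.1 h) (-inner ℝ v w) (inner ℝ v v)
      (by rw [← h0]; module)
    exact hv0.ne' this.2
  have h2 := real_inner_self_pos.2 hne
  simp only [inner_sub_left, inner_sub_right, real_inner_smul_left, real_inner_smul_right,
    real_inner_comm v w] at h2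
  have h3 : 0 < inner ℝ v v * (inner ℝ v v * inner ℝ w w - inner ℝ v w ^ 2) := by
    convert h2 using 1
    rw [real_inner_comm w v]; ring
  exact pos_of_mul_pos_right h3 hv0.le

/-- Let `n, a` be an orthonormal basis of the orthogonal complement of the plane spanned by `v, w` in a
four-dimensional space. The component of `x` in that plane is expanded in `v, w` by Cramer's rule,
multiplied by the Gram determinant. -/
lemma gram_det_smul_sub_eq {F : Type*} [NormedAddCommGroup F] [InnerProductSpace ℝ F]
    (hF : Module.finrank ℝ F = 4) {v w n a : F} (h : LinearIndependent ℝ ![v, w])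
    (hn : inner ℝ n n = (1 : ℝ)) (ha : inner ℝ a a = (1 : ℝ))
    (hna : inner ℝ n a = (0 : ℝ)) (hnv : inner ℝ n v = (0 : ℝ)) (hnw : inner ℝ n w = (0 : ℝ))
    (hav : inner ℝ a v = (0 : ℝ)) (haw : inner ℝ a w = (0 : ℝ)) (x : F) :
    (inner ℝ v v * inner ℝ w w - inner ℝ v w ^ 2 : ℝ) •
        (x - (inner ℝ n x : ℝ) • n - (inner ℝ a x : ℝ) • a) =
      (inner ℝ w w * inner ℝ v x - inner ℝ v w * inner ℝ w x : ℝ) • v +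
        (inner ℝ v v * inner ℝ w x - inner ℝ v w * inner ℝ v x : ℝ) • w := by
  have hli : LinearIndependent ℝ ![v, w, n, a] := by
    rw [Fintype.linearIndependent_iff]
    intro c hc
    simp only [Fin.sum_univ_four, Matrix.cons_val] at hc
    have h2 : c 2 = 0 := by
      have := congrArg (inner ℝ n) hc
      simpa only [inner_add_right, real_inner_smul_right, hnv, hnw, hn, hna, inner_zero_right,
        mul_zero, mul_one, add_zero, zero_add] using this
    have h3 : c 3 = 0 := by
      have := congrArg (inner ℝ a) hc
      have han : inner ℝ a n = (0 : ℝ) := by rw [real_inner_comm, hna]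
      simpa only [inner_add_right, real_inner_smul_right, hav, haw, ha, han, inner_zero_right,
        mul_zero, mul_one, add_zero, zero_add] using this
    rw [h2, h3, zero_smul, zero_smul, add_zero, add_zero] at hc
    have h01 := LinearIndependent.pair_iff.1 h _ _ hc
    intro i
    fin_cases i <;> simp [h01.1, h01.2, h2, h3]
  have hspan := hli.span_eq_top_of_card_eq_finrank (by simp [hF])
  rw [← sub_eq_zero]
  set d := (inner ℝ v v * inner ℝ w w - inner ℝ v w ^ 2 : ℝ) •
        (x - (inner ℝ n x : ℝ) • n - (inner ℝ a x : ℝ) • a) -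
      ((inner ℝ w w * inner ℝ v x - inner ℝ v w * inner ℝ w x : ℝ) • v +
        (inner ℝ v v * inner ℝ w x - inner ℝ v w * inner ℝ v x : ℝ) • w) with hd
  have hvn : inner ℝ v n = (0 : ℝ) := by rw [real_inner_comm, hnv]
  have hwn : inner ℝ w n = (0 : ℝ) := by rw [real_inner_comm, hnw]
  have hva : inner ℝ v a = (0 : ℝ) := by rw [real_inner_comm, hav]
  have hwa : inner ℝ w a = (0 : ℝ) := by rw [real_inner_comm, haw]
  have han : inner ℝ a n = (0 : ℝ) := by rw [real_inner_comm, hna]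
  have hwv : inner ℝ w v = (inner ℝ v w : ℝ) := real_inner_comm _ _
  have horth : ∀ y ∈ Submodule.span ℝ (Set.range ![v, w, n, a]), inner ℝ y d = (0 : ℝ) := by
    intro y hy
    induction hy using Submodule.span_induction with
    | mem y hy =>
      obtain ⟨i, rfl⟩ := hy
      fin_cases i <;>
      simp only [hd, inner_sub_right, inner_add_right, real_inner_smul_right, hn, ha, hna, hnv,
        hnw, hav, haw, hvn, hwn, hva, hwa, han, hwv, Fin.zero_eta, Fin.mk_one, Fin.reduceFinMk,
        Matrix.cons_val] <;> ring
    | zero => simp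
    | add y z _ _ hy hz => rw [inner_add_left, hy, hz, add_zero]
    | smul c y _ hy => rw [real_inner_smul_left, hy, mul_zero]
  exact inner_self_eq_zero.1 (horth d (by rw [hspan]; trivial))

end Algebra

section Parametrization

local notation "E2" => EuclideanSpace ℝ (Fin 2)
local notation "E4" => EuclideanSpace ℝ (Fin 4)

/-- `X` is a `C²` immersion of the open set `V ⊆ ℝ²` into `𝕊² × ℝ`, and `N` is a continuous unit normal
along it: the expression of an oriented immersed surface in a chart. Values outside `V` play no role. -/
structure IsOrientedParametrization (V : Set (EuclideanSpace ℝ (Fin 2)))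
    (X N : EuclideanSpace ℝ (Fin 2) → EuclideanSpace ℝ (Fin 4)) : Prop where
  isOpen : IsOpen V
  contDiffOn : ContDiffOn ℝ 2 X V
  injective_fderiv : ∀ u ∈ V, Function.Injective (fderiv ℝ X u)
  mem_sphereProdLine : ∀ u ∈ V, X u ∈ sphereProdLine
  continuousOn_normal : ContinuousOn N V
  norm_normal : ∀ u ∈ V, ‖N u‖ = 1
  normal_tangent_ambient : ∀ u ∈ V, inner ℝ (N u) (ambientNormal (X u)) = 0
  normal_orthogonal : ∀ u ∈ V, ∀ v, inner ℝ (N u) (fderiv ℝ X u v) = 0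

lemma inner_ambientNormal (x v : E4) :
    inner ℝ (ambientNormal x) v = x 0 * v 0 + x 1 * v 1 + x 2 * v 2 := by
  simp [ambientNormal, PiLp.inner_apply, Fin.sum_univ_four]
  ring

lemma firstForm_det (X : E2 → E4) (u : E2) :
    (firstForm X u).det = inner ℝ (partialDeriv X 0 u) (partialDeriv X 0 u) *
      inner ℝ (partialDeriv X 1 u) (partialDeriv X 1 u) -
        inner ℝ (partialDeriv X 0 u) (partialDeriv X 1 u) ^ 2 := by
  rw [Matrix.det_fin_two]
  simp [firstForm, real_inner_comm]
  ring

namespace IsOrientedParametrization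

variable {V : Set E2} {X N : E2 → E4} (h : IsOrientedParametrization V X N) {u : E2} (hu : u ∈ V)
include h hu

lemma contDiffAt : ContDiffAt ℝ 2 X u := h.contDiffOn.contDiffAt (h.isOpen.mem_nhds hu)

lemma differentiableAt : DifferentiableAt ℝ X u := (h.contDiffAt hu).differentiableAt (by simp)

lemma hasFDerivAt_fderiv : HasFDerivAt (fderiv ℝ X) (fderiv ℝ (fderiv ℝ X) u) u :=
  (((h.contDiffAt hu).fderiv_right (m := 1) (by norm_num)).differentiableAt
    (by simp)).hasFDerivAt

lemma partialDeriv_partialDeriv (i j : Fin 2) : partialDeriv (partialDeriv X j) i u =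
    fderiv ℝ (fderiv ℝ X) u (EuclideanSpace.single i 1) (EuclideanSpace.single j 1) := by
  have h1 := (h.hasFDerivAt_fderiv hu).clm_apply
    (hasFDerivAt_const (EuclideanSpace.single j (1 : ℝ) : E2) u)
  have h2 : partialDeriv X j = fun u => fderiv ℝ X u (EuclideanSpace.single j 1) := rfl
  rw [partialDeriv, h2, h1.fderiv]
  simp

lemma partialDeriv_comm (i j : Fin 2) :
    partialDeriv (partialDeriv X j) i u = partialDeriv (partialDeriv X i) j u := by
  rw [h.partialDeriv_partialDeriv hu, h.partialDeriv_partialDeriv hu]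
  exact (h.contDiffAt hu).isSymmSndFDerivAt (by simp) _ _

lemma continuousAt_partialDeriv (i : Fin 2) : ContinuousAt (partialDeriv X i) u :=
  ((h.contDiffAt hu).fderiv_right (m := 1) (by norm_num)).continuousAt.clm_apply
    continuousAt_const

lemma continuousAt_partialDeriv_partialDeriv (i j : Fin 2) :
    ContinuousAt (partialDeriv (partialDeriv X j) i) u := by
  have h1 : ContDiffAt ℝ 0 (fderiv ℝ (fderiv ℝ X)) u :=
    ((h.contDiffAt hu).fderiv_right (m := 1) (by norm_num)).fderiv_right (by norm_num)
  have h2 : ContinuousAt (fun u => fderiv ℝ (fderiv ℝ X) u (EuclideanSpace.single i 1)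
      (EuclideanSpace.single j 1)) u :=
    (h1.continuousAt.clm_apply continuousAt_const).clm_apply continuousAt_const
  refine h2.congr ?_
  filter_upwards [h.isOpen.mem_nhds hu] with x hx
  exact (h.partialDeriv_partialDeriv hx i j).symm

lemma fderiv_height : fderiv ℝ (fun u => X u 3) u =
    (EuclideanSpace.proj (3 : Fin 4) : E4 →L[ℝ] ℝ).comp (fderiv ℝ X u) :=
  ((EuclideanSpace.proj (3 : Fin 4) : E4 →L[ℝ] ℝ).hasFDerivAt.comp u
    (h.differentiableAt hu).hasFDerivAt).fderiv

lemma fderiv_fderiv_height (v w : E2) : fderiv ℝ (fderiv ℝ fun u => X u 3) u v w =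
    fderiv ℝ (fderiv ℝ X) u v w 3 := by
  have hev : (fderiv ℝ fun u => X u 3) =ᶠ[𝓝 u] fun x =>
      (ContinuousLinearMap.compL ℝ E2 E4 ℝ (EuclideanSpace.proj (3 : Fin 4))) (fderiv ℝ X x) := by
    filter_upwards [h.isOpen.mem_nhds hu] with x hx
    exact h.fderiv_height hx
  have h1 := ((ContinuousLinearMap.compL ℝ E2 E4 ℝ
    (EuclideanSpace.proj (3 : Fin 4))).hasFDerivAt).comp u (h.hasFDerivAt_fderiv hu)
  rw [(h1.congr_of_eventuallyEq hev).fderiv]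
  rfl

lemma contDiffAt_height : ContDiffAt ℝ 2 (fun u => X u 3) u :=
  (EuclideanSpace.proj (3 : Fin 4) : E4 →L[ℝ] ℝ).contDiff.contDiffAt.comp u (h.contDiffAt hu)

lemma linearIndependent_partialDeriv :
    LinearIndependent ℝ ![partialDeriv X 0 u, partialDeriv X 1 u] := by
  rw [LinearIndependent.pair_iff]
  intro s t hst
  have h1 : fderiv ℝ X u (s • EuclideanSpace.single 0 1 + t • EuclideanSpace.single 1 1) = 0 := by
    rw [map_add, map_smul, map_smul]; exact hst
  have h2 := h.injective_fderiv u hu (h1.trans (map_zero _).symm)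
  constructor
  · simpa using congrArg (fun x : E2 => x 0) h2
  · simpa using congrArg (fun x : E2 => x 1) h2

/-- The derivative of the equation `x₀² + x₁² + x₂² = 1` of `𝕊² × ℝ` along the surface. -/
lemma ambientNormal_orthogonal (i : Fin 2) :
    inner ℝ (ambientNormal (X u)) (partialDeriv X i u) = (0 : ℝ) := by
  have hc : ∀ k : Fin 4, HasFDerivAt (fun u => X u k)
      ((EuclideanSpace.proj k : E4 →L[ℝ] ℝ).comp (fderiv ℝ X u)) u := fun k =>
    (EuclideanSpace.proj k : E4 →L[ℝ] ℝ).hasFDerivAt.comp u (h.differentiableAt hu).hasFDerivAt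
  have h1 := (((hc 0).pow 2).add ((hc 1).pow 2)).add ((hc 2).pow 2)
  have h2 : (fun x => X x 0 ^ 2 + X x 1 ^ 2 + X x 2 ^ 2) =ᶠ[𝓝 u] fun _ => (1 : ℝ) := by
    filter_upwards [h.isOpen.mem_nhds hu] with x hx
    exact h.mem_sphereProdLine x hx
  have h3 := (h1.congr_of_eventuallyEq h2.symm).unique (hasFDerivAt_const (1 : ℝ) u)
  have h4 := congrArg (fun L : E2 →L[ℝ] ℝ => L (EuclideanSpace.single i 1)) h3
  rw [inner_ambientNormal]
  simp only [add_apply, smul_apply, ContinuousLinearMap.comp_apply, PiLp.proj_apply, smul_eq_mul,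
    zero_apply] at h4
  simp only [partialDeriv]
  norm_num at h4
  linarith

lemma firstForm_det_pos : 0 < (firstForm X u).det := by
  rw [firstForm_det]
  exact gram_det_pos (h.linearIndependent_partialDeriv hu)

lemma firstForm_zero_zero_pos : 0 < firstForm X u 0 0 :=
  real_inner_self_pos.2 ((h.linearIndependent_partialDeriv hu).ne_zero 0)

/-- The mean curvature with the inverse of the first fundamental form written out by cofactors. -/
lemma det_mul_meanCurvature (n : E4) : 2 * (firstForm X u).det * meanCurvature X n u =
    firstForm X u 1 1 * secondForm X n u 0 0 - 2 * firstForm X u 0 1 * secondForm X n u 0 1 +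
      firstForm X u 0 0 * secondForm X n u 1 1 := by
  have h0 := (h.firstForm_det_pos hu).ne'
  have h1 : firstForm X u 1 0 = firstForm X u 0 1 := by
    simp only [firstForm, Matrix.of_apply, real_inner_comm]
  have h2 : secondForm X n u 1 0 = secondForm X n u 0 1 := by
    simp only [secondForm, Matrix.of_apply]
    rw [h.partialDeriv_comm hu]
  rw [meanCurvature, Matrix.inv_def, Ring.inverse_eq_inv', Matrix.adjugate_fin_two,
    Matrix.trace_fin_two]
  simp only [Matrix.smul_apply, Matrix.mul_apply, Fin.sum_univ_two, smul_eq_mul,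
    Matrix.of_apply, Matrix.cons_val', Matrix.cons_val_zero, Matrix.cons_val_one,
    Matrix.cons_val_fin_one, h1, h2]
  field_simp
  ring

/-- The inner product of `x` with the decomposition `∂_z = ν N + T`, in which the tangent vector `T` is
the gradient of the height, multiplied by `det g` and with `T` expanded in `∂₀X, ∂₁X`. -/
lemma det_mul_height (x : E4) :
    (firstForm X u).det * (x 3 - N u 3 * inner ℝ x (N u)) =
      (firstForm X u 1 1 * partialDeriv X 0 u 3 - firstForm X u 0 1 * partialDeriv X 1 u 3) *
          inner ℝ x (partialDeriv X 0 u) +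
        (firstForm X u 0 0 * partialDeriv X 1 u 3 - firstForm X u 0 1 * partialDeriv X 0 u 3) *
          inner ℝ x (partialDeriv X 1 u) := by
  have ha : inner ℝ (ambientNormal (X u)) (ambientNormal (X u)) = (1 : ℝ) := by
    have := h.mem_sphereProdLine u hu
    rw [inner_ambientNormal]
    simp only [ambientNormal, sphereProdLine, Set.mem_ofPred_eq] at this ⊢
    simp
    linarith
  have hn : inner ℝ (N u) (N u) = (1 : ℝ) := by
    rw [real_inner_self_eq_norm_sq, h.norm_normal u hu]; norm_num
  have key := gram_det_smul_sub_eq (by simp) (h.linearIndependent_partialDeriv hu) hn ha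
    (h.normal_tangent_ambient u hu) (h.normal_orthogonal u hu _) (h.normal_orthogonal u hu _)
    (h.ambientNormal_orthogonal hu 0) (h.ambientNormal_orthogonal hu 1)
    (EuclideanSpace.single 3 (1 : ℝ))
  rw [← firstForm_det] at key
  have key2 := congrArg (inner ℝ x) key
  have ha3 : (ambientNormal (X u)) 3 = 0 := by simp [ambientNormal]
  simp only [real_inner_smul_right, inner_sub_right, inner_add_right,
    EuclideanSpace.inner_single_right, one_mul, conj_trivial, ha3, zero_mul, sub_zero] at key2
  rw [key2]
  rfl

/-- The identity `1 - ν² = |∇h|²` for the height `h`, multiplied by `det g`. -/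
lemma det_mul_one_sub_sq : (firstForm X u).det * (1 - N u 3 ^ 2) =
    firstForm X u 1 1 * partialDeriv X 0 u 3 ^ 2 -
      2 * firstForm X u 0 1 * (partialDeriv X 0 u 3 * partialDeriv X 1 u 3) +
      firstForm X u 0 0 * partialDeriv X 1 u 3 ^ 2 := by
  have := h.det_mul_height hu (EuclideanSpace.single 3 (1 : ℝ))
  simp [EuclideanSpace.inner_single_left] at this
  linarith

end IsOrientedParametrization

end Parametrization

/-! ### The equation of the height function -/

section HeightEquation

local notation "E2" => EuclideanSpace ℝ (Fin 2)
local notation "E4" => EuclideanSpace ℝ (Fin 4)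

/-- Vector fields `e₀, e₁` on the parameter domain with
`∑ D²w(eᵢ, eᵢ) = g₀₀ (det g)² tr (g⁻¹ D²w)`: they write the principal part of the Laplacian of the surface,
up to a positive factor, as a sum of squares (completion of the square in `g₁₁ a² - 2 g₀₁ a b + g₀₀ b²`). -/
noncomputable def ellipticFrame (X : EuclideanSpace ℝ (Fin 2) → EuclideanSpace ℝ (Fin 4)) (i : Fin 2)
    (u : EuclideanSpace ℝ (Fin 2)) : EuclideanSpace ℝ (Fin 2) :=
  ![(firstForm X u).det • EuclideanSpace.single 0 1,
    √(firstForm X u).det • (-firstForm X u 0 1 • EuclideanSpace.single 0 1 +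
      firstForm X u 0 0 • EuclideanSpace.single 1 1)] i

/-- The contraction of `⟨∂ᵢ∂ⱼX, ∂ₖX⟩` with the cofactor matrix of `g`, that is `det g · gⁱʲ ⟨∂ᵢ∂ⱼX, ∂ₖX⟩`:
the Christoffel symbols entering the Laplacian, with the index lowered. -/
noncomputable def secondDerivTangential (X : EuclideanSpace ℝ (Fin 2) → EuclideanSpace ℝ (Fin 4))
    (k : Fin 2) (u : EuclideanSpace ℝ (Fin 2)) : ℝ :=
  firstForm X u 1 1 * inner ℝ (partialDeriv (partialDeriv X 0) 0 u) (partialDeriv X k u) -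
    2 * firstForm X u 0 1 * inner ℝ (partialDeriv (partialDeriv X 1) 0 u) (partialDeriv X k u) +
    firstForm X u 0 0 * inner ℝ (partialDeriv (partialDeriv X 1) 1 u) (partialDeriv X k u)

namespace IsOrientedParametrization

variable {V : Set E2} {X N : E2 → E4} (h : IsOrientedParametrization V X N) {u : E2} (hu : u ∈ V)
include h hu

lemma continuousAt_firstForm (i j : Fin 2) : ContinuousAt (fun u => firstForm X u i j) u :=
  (h.continuousAt_partialDeriv hu i).inner (h.continuousAt_partialDeriv hu j)

lemma continuousAt_det : ContinuousAt (fun u => (firstForm X u).det) u := by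
  simp only [Matrix.det_fin_two]
  exact ((h.continuousAt_firstForm hu 0 0).mul (h.continuousAt_firstForm hu 1 1)).sub
    ((h.continuousAt_firstForm hu 0 1).mul (h.continuousAt_firstForm hu 1 0))

lemma continuousAt_ellipticFrame (i : Fin 2) : ContinuousAt (ellipticFrame X i) u := by
  have hd := h.continuousAt_det hu
  have h01 := h.continuousAt_firstForm hu 0 1
  have h00 := h.continuousAt_firstForm hu 0 0
  fin_cases i
  · exact hd.smul continuousAt_const
  · exact hd.sqrt.smul ((h01.neg.smul continuousAt_const).add (h00.smul continuousAt_const))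

lemma continuousAt_secondDerivTangential (k : Fin 2) :
    ContinuousAt (secondDerivTangential X k) u := by
  have hX := h.continuousAt_partialDeriv_partialDeriv hu
  have hk := h.continuousAt_partialDeriv hu k
  have hg := h.continuousAt_firstForm hu
  exact (((hg 1 1).mul ((hX 0 0).inner hk)).sub
    (((continuousAt_const.mul (hg 0 1))).mul ((hX 0 1).inner hk))).add
      ((hg 0 0).mul ((hX 1 1).inner hk))

lemma eq_zero_of_inner_ellipticFrame_eq_zero {d : E2}
    (hd : ∀ i, inner ℝ (ellipticFrame X i u) d = 0) : d = 0 := by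
  have hP := h.firstForm_det_pos hu
  have h0 : d 0 = 0 := by
    have := hd 0
    simpa [ellipticFrame, real_inner_smul_left, EuclideanSpace.inner_single_left, hP.ne'] using this
  have h1 : d 1 = 0 := by
    have := hd 1
    simpa [ellipticFrame, real_inner_smul_left, EuclideanSpace.inner_single_left, inner_add_left,
      (Real.sqrt_pos.2 hP).ne', h0, (h.firstForm_zero_zero_pos hu).ne'] using this
  ext i
  fin_cases i <;> simp [h0, h1]

lemma sum_hessian_ellipticFrame :
    ∑ i, fderiv ℝ (fderiv ℝ fun u => X u 3) u (ellipticFrame X i u) (ellipticFrame X i u) =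
      (firstForm X u).det * firstForm X u 0 0 *
        (firstForm X u 1 1 * partialDeriv (partialDeriv X 0) 0 u 3 -
          2 * firstForm X u 0 1 * partialDeriv (partialDeriv X 1) 0 u 3 +
          firstForm X u 0 0 * partialDeriv (partialDeriv X 1) 1 u 3) := by
  have hs : √(firstForm X u).det * √(firstForm X u).det = (firstForm X u).det :=
    Real.mul_self_sqrt (h.firstForm_det_pos hu).le
  have hdet : (firstForm X u).det =
      firstForm X u 0 0 * firstForm X u 1 1 - firstForm X u 0 1 ^ 2 := firstForm_det X u
  have h10 : partialDeriv (partialDeriv X 0) 1 u 3 = partialDeriv (partialDeriv X 1) 0 u 3 := by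
    rw [h.partialDeriv_comm hu]
  simp only [Fin.sum_univ_two, h.fderiv_fderiv_height hu, ellipticFrame, Matrix.cons_val_zero,
    Matrix.cons_val_one, map_smul, map_add, smul_apply, add_apply,
    ← h.partialDeriv_partialDeriv hu, PiLp.smul_apply, PiLp.add_apply, smul_eq_mul, h10]
  generalize partialDeriv (partialDeriv X 0) 0 u 3 = k00
  generalize partialDeriv (partialDeriv X 1) 0 u 3 = k01
  generalize partialDeriv (partialDeriv X 1) 1 u 3 = k11
  linear_combination (firstForm X u 0 1 ^ 2 * k00 - 2 * firstForm X u 0 1 * firstForm X u 0 0 * k01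
    + firstForm X u 0 0 ^ 2 * k11) * hs + (firstForm X u).det * k00 * hdet

/-- The equation `Δh = 2 H ν` for the height of a surface in `𝕊² × ℝ`, multiplied by `g₀₀ (det g)²`, with
the first order terms of the Laplacian moved to the right side. -/
lemma sum_hessian_ellipticFrame_eq :
    ∑ i, fderiv ℝ (fderiv ℝ fun u => X u 3) u (ellipticFrame X i u) (ellipticFrame X i u) =
      firstForm X u 0 0 * (2 * (firstForm X u).det ^ 2 * (N u 3 * meanCurvature X (N u) u) +
        (firstForm X u 1 1 * partialDeriv X 0 u 3 - firstForm X u 0 1 * partialDeriv X 1 u 3) *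
          secondDerivTangential X 0 u +
        (firstForm X u 0 0 * partialDeriv X 1 u 3 - firstForm X u 0 1 * partialDeriv X 0 u 3) *
          secondDerivTangential X 1 u) := by
  rw [h.sum_hessian_ellipticFrame hu]
  have h00 := h.det_mul_height hu (partialDeriv (partialDeriv X 0) 0 u)
  have h01 := h.det_mul_height hu (partialDeriv (partialDeriv X 1) 0 u)
  have h11 := h.det_mul_height hu (partialDeriv (partialDeriv X 1) 1 u)
  have hH := h.det_mul_meanCurvature hu (N u)
  simp only [secondForm, Matrix.of_apply] at hH
  simp only [secondDerivTangential]
  linear_combination firstForm X u 0 0 * (firstForm X u 1 1 * h00 - 2 * firstForm X u 0 1 * h01 +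
    firstForm X u 0 0 * h11 - (firstForm X u).det * N u 3 * hH)

lemma abs_partialDeriv_height_le (i : Fin 2) :
    |partialDeriv X i u 3| ≤ ‖fderiv ℝ (fun u => X u 3) u‖ := by
  have h1 := (fderiv ℝ (fun u => X u 3) u).le_opNorm (EuclideanSpace.single i 1)
  rw [h.fderiv_height hu] at h1 ⊢
  simpa [partialDeriv] using h1

lemma partialDeriv_height_eq_zero (hgrad : fderiv ℝ (fun u => X u 3) u = 0) (i : Fin 2) :
    partialDeriv X i u 3 = 0 := by
  have := h.abs_partialDeriv_height_le hu i
  rwa [hgrad, norm_zero, abs_nonpos_iff] at this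

/-- The normal is vertical at critical points of the height. -/
lemma sq_angle_eq_one (hgrad : fderiv ℝ (fun u => X u 3) u = 0) : N u 3 ^ 2 = 1 := by
  have h1 := h.det_mul_one_sub_sq hu
  rw [h.partialDeriv_height_eq_zero hu hgrad, h.partialDeriv_height_eq_zero hu hgrad] at h1
  have h2 : (firstForm X u).det * (1 - N u 3 ^ 2) = 0 := by linarith
  have := (mul_eq_zero.1 h2).resolve_left (h.firstForm_det_pos hu).ne'
  linarith

/-- At a maximum of the height (`σ > 0`) or a minimum (`σ < 0`) the Laplacian `2 H ν` of the height has
a sign. -/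
lemma mul_angle_mul_meanCurvature_nonpos {σ : ℝ} (hmax : IsLocalMax (fun u => σ * X u 3) u)
    (hgrad : fderiv ℝ (fun u => X u 3) u = 0) : σ * (N u 3 * meanCurvature X (N u) u) ≤ 0 := by
  have hC := h.contDiffAt_height hu
  have h1 : ∀ v, σ * fderiv ℝ (fderiv ℝ fun u => X u 3) u v v ≤ 0 := by
    intro v
    have h2 := hmax.fderiv_fderiv_nonpos (contDiffAt_const.mul hC) v
    have h3 : (fderiv ℝ fun u => σ * X u 3) =ᶠ[𝓝 u] fun x => σ • fderiv ℝ (fun u => X u 3) x := by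
      filter_upwards [h.isOpen.mem_nhds hu] with x hx
      exact fderiv_const_mul ((h.contDiffAt_height hx).differentiableAt (by simp)) σ
    have h4 := ((hC.fderiv_right (m := 1) (by norm_num)).differentiableAt (by simp)).hasFDerivAt
    rw [((h4.const_smul σ).congr_of_eventuallyEq h3).fderiv] at h2
    simpa using h2
  have h5 := Finset.sum_nonpos fun i (_ : i ∈ Finset.univ) => h1 (ellipticFrame X i u)
  rw [← Finset.mul_sum, h.sum_hessian_ellipticFrame_eq hu,
    h.partialDeriv_height_eq_zero hu hgrad, h.partialDeriv_height_eq_zero hu hgrad] at h5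
  have h6 := mul_pos (h.firstForm_zero_zero_pos hu) (pow_pos (h.firstForm_det_pos hu) 2)
  by_contra! h7
  nlinarith [mul_pos h6 h7]

/-- If `H(ε) = 0` to first order, then where the normal points to the side of `ε ∂_z` the right side of the
height equation is locally bounded by a multiple of the gradient of the height: the first order terms
obviously, and the curvature term because `|H(ν)| ≤ L (1 - εν) ≤ L (1 - ν²) = L |∇h|²`. -/
lemma exists_abs_sum_hessian_le {H : ℝ → ℝ}
    (hH : ∀ x ∈ V, meanCurvature X (N x) x = H (N x 3)) {ε L : ℝ} (hε : ε ^ 2 = 1)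
    (hL : ∀ y ∈ Set.Icc (-1 : ℝ) 1, |H y| ≤ L * (1 - ε * y)) (hL0 : 0 ≤ L) (hN : 0 < ε * N u 3) :
    ∃ C, ∀ᶠ x in 𝓝 u,
      |∑ i, fderiv ℝ (fderiv ℝ fun u => X u 3) x (ellipticFrame X i x) (ellipticFrame X i x)| ≤
        C * ‖fderiv ℝ (fun u => X u 3) x‖ := by
  set Φ : E2 → ℝ := fun x => firstForm X x 0 0 *
    (2 * L * (firstForm X x).det * (|firstForm X x 1 1| + 2 * |firstForm X x 0 1| +
        |firstForm X x 0 0|) * ‖fderiv ℝ (fun u => X u 3) x‖ +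
      (|firstForm X x 1 1| + |firstForm X x 0 1|) * |secondDerivTangential X 0 x| +
      (|firstForm X x 0 0| + |firstForm X x 0 1|) * |secondDerivTangential X 1 x|) with hΦ
  have hΦc : ContinuousAt Φ u := by
    have h00 := h.continuousAt_firstForm hu 0 0
    have h01 := h.continuousAt_firstForm hu 0 1
    have h11 := h.continuousAt_firstForm hu 1 1
    have hd := h.continuousAt_det hu
    have hs := h.continuousAt_secondDerivTangential hu
    have hn := (((h.contDiffAt_height hu).fderiv_right (m := 1) (by norm_num)).continuousAt).norm
    exact h00.mul (((((continuousAt_const.mul hd).mul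
      ((h11.abs.add (continuousAt_const.mul h01.abs)).add h00.abs)).mul hn).add
      ((h11.abs.add h01.abs).mul (hs 0).abs)).add ((h00.abs.add h01.abs).mul (hs 1).abs))
  have hNc : ContinuousAt (fun x => ε * N x 3) u :=
    continuousAt_const.mul ((EuclideanSpace.proj (3 : Fin 4) : E4 →L[ℝ] ℝ).continuous.continuousAt.comp
      (h.continuousOn_normal.continuousAt (h.isOpen.mem_nhds hu)))
  refine ⟨Φ u + 1, ?_⟩
  filter_upwards [h.isOpen.mem_nhds hu, hΦc.eventually_lt_const (lt_add_one (Φ u)),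
    hNc.eventually_const_lt hN] with x hx hxΦ hxN
  refine le_trans ?_ (mul_le_mul_of_nonneg_right hxΦ.le (norm_nonneg _))
  set n := ‖fderiv ℝ (fun u => X u 3) x‖ with hn
  have hn0 : 0 ≤ n := norm_nonneg _
  have hp0 := h.abs_partialDeriv_height_le hx 0
  have hp1 := h.abs_partialDeriv_height_le hx 1
  have hP := h.firstForm_det_pos hx
  have hg0 := h.firstForm_zero_zero_pos hx
  have hgrad := h.det_mul_one_sub_sq hx
  rw [h.sum_hessian_ellipticFrame_eq hx, hH x hx]
  simp only [hΦ]
  rw [← hn] at hp0 hp1 ⊢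
  set ν := N x 3
  set P := (firstForm X x).det
  set a := firstForm X x 0 0
  set b := firstForm X x 0 1
  set c := firstForm X x 1 1
  set p := partialDeriv X 0 x 3
  set q := partialDeriv X 1 x 3
  have hν : ν ^ 2 ≤ 1 := by
    have h1 := PiLp.norm_apply_le (N x) 3
    rw [h.norm_normal x hx, Real.norm_eq_abs] at h1
    exact (sq_le_one_iff_abs_le_one _).2 h1
  have hν1 : |ν| ≤ 1 := (sq_le_one_iff_abs_le_one _).1 hν
  have hquad : P * (1 - ν ^ 2) ≤ (|c| + 2 * |b| + |a|) * n * n := by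
    rw [hgrad]
    have e1 : c * p ^ 2 ≤ |c| * (n * n) := by
      have : p ^ 2 ≤ n * n := by rw [← sq_abs, sq]; gcongr
      exact mul_le_mul (le_abs_self c) this (sq_nonneg p) (abs_nonneg c)
    have e2 : a * q ^ 2 ≤ |a| * (n * n) := by
      have : q ^ 2 ≤ n * n := by rw [← sq_abs, sq]; gcongr
      exact mul_le_mul (le_abs_self a) this (sq_nonneg q) (abs_nonneg a)
    have e3 : -(b * (p * q)) ≤ |b| * (n * n) := by
      refine (neg_le_abs _).trans ?_
      rw [abs_mul, abs_mul]
      gcongr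
    linarith
  have hHν : |ν * H ν| ≤ L * (1 - ν ^ 2) := by
    have e1 := hL ν (abs_le.1 hν1)
    have e2 : 1 - ε * ν ≤ 1 - ν ^ 2 := by
      have : (ε * ν) ^ 2 ≤ 1 := by rw [mul_pow, hε, one_mul]; exact hν
      have : ν ^ 2 = (ε * ν) ^ 2 := by rw [mul_pow, hε, one_mul]
      nlinarith
    rw [abs_mul]
    have e3 : |ν| * |H ν| ≤ 1 * |H ν| := by gcongr
    have e4 := mul_le_mul_of_nonneg_left e2 hL0
    linarith
  rw [abs_mul]
  conv_lhs => rw [abs_of_pos hg0]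
  rw [mul_assoc a]
  refine mul_le_mul_of_nonneg_left ?_ hg0.le
  have t1 : |2 * P ^ 2 * (ν * H ν)| ≤ 2 * L * P * (|c| + 2 * |b| + |a|) * n * n := by
    rw [abs_mul, abs_of_pos (by positivity)]
    calc 2 * P ^ 2 * |ν * H ν| ≤ 2 * P ^ 2 * (L * (1 - ν ^ 2)) := by gcongr
      _ = 2 * L * P * (P * (1 - ν ^ 2)) := by ring
      _ ≤ 2 * L * P * ((|c| + 2 * |b| + |a|) * n * n) := by gcongr
      _ = _ := by ring
  have t2 : ∀ s : ℝ, |(c * p - b * q) * s| ≤ (|c| + |b|) * |s| * n := by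
    intro s
    rw [abs_mul]
    calc |c * p - b * q| * |s| ≤ (|c| * n + |b| * n) * |s| := by
          gcongr
          refine (abs_sub _ _).trans ?_
          rw [abs_mul, abs_mul]
          gcongr
      _ = _ := by ring
  have t3 : ∀ s : ℝ, |(a * q - b * p) * s| ≤ (|a| + |b|) * |s| * n := by
    intro s
    rw [abs_mul]
    calc |a * q - b * p| * |s| ≤ (|a| * n + |b| * n) * |s| := by
          gcongr
          refine (abs_sub _ _).trans ?_
          rw [abs_mul, abs_mul]
          gcongr
      _ = _ := by ring
  refine (abs_add_three _ _ _).trans ?_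
  have := t2 (secondDerivTangential X 0 x)
  have := t3 (secondDerivTangential X 1 x)
  linarith

/-- The tangency principle with a horizontal slice: if the height is extremal at `u`, the normal there is
`ε ∂_z`, and `H(ε) = 0` to first order, then the surface is a horizontal slice with normal `ε ∂_z` near `u`. -/
lemma eventually_height_eq {H : ℝ → ℝ}
    (hH : ∀ x ∈ V, meanCurvature X (N x) x = H (N x 3)) {ε L σ : ℝ} (hε : ε ^ 2 = 1)
    (hL : ∀ y ∈ Set.Icc (-1 : ℝ) 1, |H y| ≤ L * (1 - ε * y)) (hL0 : 0 ≤ L) (hN : N u 3 = ε)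
    (hσ : σ ^ 2 = 1) (hmax : ∀ x ∈ V, σ * X x 3 ≤ σ * X u 3) :
    ∀ᶠ x in 𝓝 u, X x 3 = X u 3 ∧ N x 3 = ε := by
  have hN0 : 0 < ε * N u 3 := by rw [hN]; nlinarith
  obtain ⟨C, hC⟩ := h.exists_abs_sum_hessian_le hu hH hε hL hL0 hN0
  obtain ⟨U, hUV, hUo, huU⟩ :=
    eventually_nhds_iff.1 ((h.isOpen.eventually_mem hu).and hC)
  set w : E2 → ℝ := fun x => σ * X x 3 - σ * X u 3 with hw
  have hσ1 : |σ| = 1 := by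
    rw [← sq_abs] at hσ
    nlinarith [abs_nonneg σ]
  have hw1 : ∀ x ∈ V, fderiv ℝ w x = σ • fderiv ℝ (fun u => X u 3) x := by
    intro x hx
    rw [hw, fderiv_sub_const]
    exact fderiv_const_mul ((h.contDiffAt_height hx).differentiableAt (by simp)) σ
  have hzero : ∀ᶠ x in 𝓝 u, w x = 0 := by
    refine eventually_eq_zero_of_nonpos_of_elliptic hUo (e := ellipticFrame X) (C := C) ?_
      (fun i x hx => (h.continuousAt_ellipticFrame (hUV x hx).1 i).continuousWithinAt)
      (fun x hx d hd => h.eq_zero_of_inner_ellipticFrame_eq_zero (hUV x hx).1 hd) ?_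
      (fun x hx => sub_nonpos.2 (hmax x (hUV x hx).1)) huU (sub_self _)
    · exact fun x hx => ((contDiffAt_const.mul
        (h.contDiffAt_height (hUV x hx).1)).sub contDiffAt_const).contDiffWithinAt
    · intro x hx
      have hxV := (hUV x hx).1
      have h3 : fderiv ℝ w =ᶠ[𝓝 x] fun x => σ • fderiv ℝ (fun u => X u 3) x := by
        filter_upwards [h.isOpen.mem_nhds hxV] with y hy using hw1 y hy
      have h4 := (((h.contDiffAt_height hxV).fderiv_right (m := 1) (by norm_num)).differentiableAt
        (by simp)).hasFDerivAt
      rw [((h4.const_smul σ).congr_of_eventuallyEq h3).fderiv, hw1 x hxV, norm_smul, Real.norm_eq_abs, hσ1,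
        one_mul]
      simp only [smul_apply, smul_eq_mul, ← Finset.mul_sum]
      have h5 := (hUV x hx).2
      have h6 := neg_abs_le (σ * ∑ i, fderiv ℝ (fderiv ℝ fun u => X u 3) x
        (ellipticFrame X i x) (ellipticFrame X i x))
      rw [abs_mul, hσ1, one_mul] at h6
      linarith
  have hNc : ContinuousAt (fun x => ε * N x 3) u :=
    continuousAt_const.mul ((EuclideanSpace.proj (3 : Fin 4) : E4 →L[ℝ] ℝ).continuous.continuousAt.comp
      (h.continuousOn_normal.continuousAt (h.isOpen.mem_nhds hu)))
  have hσ0 : σ ≠ 0 := fun h0 => by simp [h0] at hσ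
  have hheight : ∀ᶠ x in 𝓝 u, X x 3 = X u 3 := by
    filter_upwards [hzero] with x hx
    exact mul_left_cancel₀ hσ0 (sub_eq_zero.1 hx)
  filter_upwards [hheight.eventually_nhds, h.isOpen.mem_nhds hu,
    hNc.eventually_const_lt hN0] with x hx hxV hxN
  refine ⟨hx.self_of_nhds, ?_⟩
  have hgrad : fderiv ℝ (fun u => X u 3) x = 0 := by
    rw [EventuallyEq.fderiv_eq (f := fun _ => X u 3) hx]; simp
  have h1 := h.sq_angle_eq_one hxV hgrad
  have h2 : (ε * N x 3 - 1) * (ε * N x 3 + 1) = 0 := by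
    have : (ε * N x 3) ^ 2 = 1 := by rw [mul_pow, hε, h1, one_mul]
    linarith
  have h3 : ε * N x 3 = 1 := by
    rcases mul_eq_zero.1 h2 with h | h <;> linarith
  calc N x 3 = ε ^ 2 * N x 3 := by rw [hε, one_mul]
    _ = ε * (ε * N x 3) := by ring
    _ = ε := by rw [h3, mul_one]

end IsOrientedParametrization

end HeightEquation

/-! ### Global argument -/

section Global

local notation "E2" => EuclideanSpace ℝ (Fin 2)
local notation "E4" => EuclideanSpace ℝ (Fin 4)

namespace IsPrescribedMeanCurvatureSurface

variable {H : ℝ → ℝ} {M : Type*} [TopologicalSpace M] [ChartedSpace (EuclideanSpace ℝ (Fin 2)) M]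
  [IsManifold (𝓡 2) 2 M] {f η : M → EuclideanSpace ℝ (Fin 4)}
  (hf : IsPrescribedMeanCurvatureSurface H f η)
include hf

/-- The inverse of a chart expresses the surface as an oriented parametrization. -/
lemma isOrientedParametrization (p : M) : IsOrientedParametrization (chartAt E2 p).target
    (f ∘ (chartAt E2 p).symm) (η ∘ (chartAt E2 p).symm) := by
  have : IsManifold (𝓡 2) 1 M := IsManifold.of_le (n := 2) (by norm_num)
  set φ := chartAt E2 p with hφ
  have hmd : φ.MDifferentiable (𝓡 2) (𝓡 2) := mdifferentiable_of_mem_atlas (chart_mem_atlas E2 p)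
  have hcomp : ∀ u ∈ φ.target, fderiv ℝ (f ∘ φ.symm) u =
      (mfderiv (𝓡 2) 𝓘(ℝ, E4) f (φ.symm u)).comp (mfderiv (𝓡 2) (𝓡 2) φ.symm u) := by
    intro u hu
    rw [← mfderiv_eq_fderiv]
    exact mfderiv_comp u (hf.contMDiff.mdifferentiable (by simp) _)
      (hmd.mdifferentiableAt_symm hu)
  refine ⟨φ.open_target, ?_, ?_, fun u _ => hf.mem_sphereProdLine _,
    hf.continuous_normal.comp_continuousOn φ.continuousOn_symm, fun u _ => hf.norm_normal _,
    fun u _ => hf.normal_tangent_ambient _, ?_⟩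
  · rw [← contMDiffOn_iff_contDiffOn]
    exact hf.contMDiff.comp_contMDiffOn
      (contMDiffOn_symm_of_mem_maximalAtlas (IsManifold.chart_mem_maximalAtlas p))
  · intro u hu
    rw [hcomp u hu]
    exact (hf.injective_mfderiv _).comp (hmd.symm.mfderiv_injective hu)
  · intro u hu v
    rw [hcomp u hu]
    exact hf.normal_orthogonal (φ.symm u) _

lemma meanCurvature_chart (p : M) : ∀ u ∈ (chartAt E2 p).target,
    meanCurvature (f ∘ (chartAt E2 p).symm) ((η ∘ (chartAt E2 p).symm) u) u =
      H ((η ∘ (chartAt E2 p).symm) u 3) := by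
  intro u hu
  have := hf.meanCurvature_eq _ (IsManifold.chart_mem_maximalAtlas p) _
    ((chartAt E2 p).map_target hu)
  rwa [(chartAt E2 p).right_inv hu] at this

/-- At a highest (`σ > 0`) or lowest (`σ < 0`) point the normal is vertical, and `H(ν) ν` is nonpositive,
respectively nonnegative. -/
lemma sq_angle_eq_one_and_mul_nonpos {σ : ℝ} (hσ : σ ≠ 0) {p : M}
    (hmax : ∀ q, σ * f q 3 ≤ σ * f p 3) : η p 3 ^ 2 = 1 ∧ σ * (η p 3 * H (η p 3)) ≤ 0 := by
  have h := hf.isOrientedParametrization p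
  have hH := hf.meanCurvature_chart p
  set φ := chartAt E2 p with hφ
  have hu : φ p ∈ φ.target := mem_chart_target E2 p
  have hs : φ.symm (φ p) = p := φ.left_inv (mem_chart_source E2 p)
  have hloc : IsLocalMax (fun u => σ * (f ∘ φ.symm) u 3) (φ p) :=
    Eventually.of_forall fun u => by
      simp only [Function.comp_apply, hs]; exact hmax _
  have hgrad : fderiv ℝ (fun u => (f ∘ φ.symm) u 3) (φ p) = 0 := by
    have h1 := hloc.fderiv_eq_zero
    have h2 := fderiv_const_mul ((h.contDiffAt_height hu).differentiableAt (by simp)) σ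
    rw [h2] at h1
    exact (smul_eq_zero.1 h1).resolve_left hσ
  have h3 := h.sq_angle_eq_one hu hgrad
  have h4 := h.mul_angle_mul_meanCurvature_nonpos hu hloc hgrad
  rw [hH _ hu] at h4
  simp only [Function.comp_apply, hs] at h3 h4
  exact ⟨h3, h4⟩

/-- The tangency principle with a horizontal slice, on the surface. -/
lemma eventually_height_eq {ε L σ : ℝ} (hε : ε ^ 2 = 1)
    (hL : ∀ y ∈ Set.Icc (-1 : ℝ) 1, |H y| ≤ L * (1 - ε * y)) (hL0 : 0 ≤ L)
    (hσ : σ ^ 2 = 1) {p : M} (hN : η p 3 = ε) (hmax : ∀ q, σ * f q 3 ≤ σ * f p 3) :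
    ∀ᶠ q in 𝓝 p, f q 3 = f p 3 ∧ η q 3 = ε := by
  have h := hf.isOrientedParametrization p
  have hH := hf.meanCurvature_chart p
  set φ := chartAt E2 p with hφ
  have hp : p ∈ φ.source := mem_chart_source E2 p
  have hu : φ p ∈ φ.target := mem_chart_target E2 p
  have hs : φ.symm (φ p) = p := φ.left_inv hp
  have key := h.eventually_height_eq hu hH hε hL hL0 (by simpa [hs] using hN) hσ
    (fun x _ => by simpa [hs] using hmax (φ.symm x))
  filter_upwards [(φ.continuousAt hp).eventually key, φ.open_source.mem_nhds hp] with q hq hqs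
  simpa [hs, φ.left_inv hqs] using hq

/-- A connected surface which at a highest or lowest point has normal `ε ∂_z` with `H(ε) = 0` lies in a
horizontal slice: the extremal points with normal `ε ∂_z` form a closed set, which is open by the tangency
principle. -/
theorem height_eq_of_isZeroOfMultiplicity [PreconnectedSpace M] {ε σ : ℝ} (hε : ε ^ 2 = 1)
    {m : ℕ} (hzero : IsZeroOfMultiplicity H ε m) (hσ : σ ^ 2 = 1) {p : M} (hN : η p 3 = ε)
    (hmax : ∀ q, σ * f q 3 ≤ σ * f p 3) (q : M) : f q 3 = f p 3 := by
  obtain ⟨L, hL0, hL⟩ : ∃ L, 0 ≤ L ∧ ∀ y ∈ Set.Icc (-1 : ℝ) 1, |H y| ≤ L * (1 - ε * y) := by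
    obtain ⟨hm, g, hg, -, hHg⟩ := hzero
    obtain ⟨B, hB⟩ := isCompact_Icc.exists_bound_of_continuousOn hg
    have hB0 : 0 ≤ B := (norm_nonneg _).trans (hB 1 (by norm_num))
    refine ⟨2 ^ (m - 1) * B, by positivity, fun y hy => ?_⟩
    have hε1 : |ε| = 1 := by rw [← sq_abs] at hε; nlinarith [abs_nonneg ε]
    have hεy : |ε * y| ≤ 1 := by
      rw [abs_mul, hε1, one_mul]; exact abs_le.2 hy
    have h1 : |y - ε| = 1 - ε * y := by
      have h2 : y - ε = -ε * (1 - ε * y) := by linear_combination -y * hε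
      rw [h2, abs_mul, abs_neg, hε1, one_mul, abs_of_nonneg]
      linarith [(abs_le.1 hεy).2]
    have h3 : (0 : ℝ) ≤ 1 - ε * y := h1 ▸ abs_nonneg _
    have h4 : 1 - ε * y ≤ 2 := by linarith [(abs_le.1 hεy).1]
    obtain ⟨k, rfl⟩ := Nat.exists_eq_add_of_le' hm
    rw [hHg y hy, abs_mul, abs_pow, h1, pow_succ, Nat.add_sub_cancel]
    have h5 : |g y| ≤ B := hB y hy
    have h6 : (1 - ε * y) ^ k ≤ 2 ^ k := by gcongr
    calc (1 - ε * y) ^ k * (1 - ε * y) * |g y| ≤ 2 ^ k * (1 - ε * y) * B := by gcongr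
      _ = _ := by ring
  have hηc : Continuous fun q => η q 3 :=
    (EuclideanSpace.proj (3 : Fin 4) : E4 →L[ℝ] ℝ).continuous.comp hf.continuous_normal
  have hfc : Continuous fun q => f q 3 :=
    (EuclideanSpace.proj (3 : Fin 4) : E4 →L[ℝ] ℝ).continuous.comp hf.contMDiff.continuous
  have hclopen : IsClopen {q | f q 3 = f p 3 ∧ η q 3 = ε} := by
    refine ⟨(isClosed_eq hfc continuous_const).inter (isClosed_eq hηc continuous_const), ?_⟩
    rw [isOpen_iff_mem_nhds]
    rintro q ⟨hq, hqN⟩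
    have := hf.eventually_height_eq hε hL hL0 hσ hqN (fun r => by rw [hq]; exact hmax r)
    rw [hq] at this
    exact this
  have huniv := hclopen.eq_univ ⟨p, rfl, hN⟩
  have hq : q ∈ {q | f q 3 = f p 3 ∧ η q 3 = ε} := huniv ▸ Set.mem_univ q
  exact hq.1

end IsPrescribedMeanCurvatureSurface

end Global

theorem proposition3p7 (H : ℝ → ℝ) (hH : ContDiffOn ℝ 1 H (Set.Icc (-1) 1))
    (hfin : {z : ℝ | z ∈ Set.Icc (-1) 1 ∧ H z = 0}.Finite)
    (m : ℝ → ℕ)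
    (hm : ∀ z ∈ Set.Icc (-1 : ℝ) 1, H z = 0 → IsZeroOfMultiplicity H z (m z))
    {M : Type*} [TopologicalSpace M] [ChartedSpace (EuclideanSpace ℝ (Fin 2)) M]
    [IsManifold (𝓡 2) 2 M]
    (hM : Nonempty (M ≃ₜ Metric.sphere (0 : EuclideanSpace ℝ (Fin 3)) 1))
    (f η : M → EuclideanSpace ℝ (Fin 4))
    (hf : IsPrescribedMeanCurvatureSurface H f η)
    (hslice : ¬ ∃ t : ℝ, ∀ p : M, f p 3 = t) :
    Even (∑ z ∈ hfin.toFinset, m z) := by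
  obtain ⟨Ψ⟩ := hM
  have hconn : IsConnected (Metric.sphere (0 : EuclideanSpace ℝ (Fin 3)) 1) :=
    isConnected_sphere (by simp [← Module.finrank_eq_rank]) 0 zero_le_one
  have : ConnectedSpace (Metric.sphere (0 : EuclideanSpace ℝ (Fin 3)) 1) :=
    isConnected_iff_connectedSpace.1 hconn
  have : ConnectedSpace M := Ψ.symm.surjective.connectedSpace Ψ.symm.continuous
  have : CompactSpace M := Ψ.symm.compactSpace
  have hfc : Continuous fun q => f q 3 :=
    (EuclideanSpace.proj (3 : Fin 4) : EuclideanSpace ℝ (Fin 4) →L[ℝ] ℝ).continuous.comp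
      hf.contMDiff.continuous
  -- The extremum of the height with sign `σ` has normal `ε ∂_z`, and `H(ε) = 0` is excluded since the
  -- surface is not a slice.
  have hstrict : ∀ σ : ℝ, σ ^ 2 = 1 →
      ∃ ε : ℝ, ε ^ 2 = 1 ∧ σ * (ε * H ε) < 0 := by
    intro σ hσ
    obtain ⟨p, -, hp⟩ := isCompact_univ.exists_isMaxOn Set.univ_nonempty
      (continuous_const.mul hfc : Continuous fun q => σ * f q 3).continuousOn
    have hmax : ∀ q, σ * f q 3 ≤ σ * f p 3 := fun q => hp (Set.mem_univ q)
    have hσ0 : σ ≠ 0 := fun h0 => by simp [h0] at hσ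
    obtain ⟨h1, h2⟩ := hf.sq_angle_eq_one_and_mul_nonpos hσ0 hmax
    refine ⟨η p 3, h1, lt_of_le_of_ne h2 fun h3 => hslice ⟨f p 3, ?_⟩⟩
    have hε0 : η p 3 ≠ 0 := fun h0 => by simp [h0] at h1
    have hI : η p 3 ∈ Set.Icc (-1 : ℝ) 1 := abs_le.1 ((sq_le_one_iff_abs_le_one _).1 h1.le)
    have h4 : H (η p 3) = 0 := by simpa [hσ0, hε0] using h3
    exact hf.height_eq_of_isZeroOfMultiplicity h1 (hm _ hI h4) hσ rfl hmax
  -- Let `a`, `b` be the angles at the top and at the bottom: `a H(a) < 0 < b H(b)`, so that `a = -b`.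
  have hprod : 0 < H 1 * H (-1) := by
    have hsq : ∀ x : ℝ, x ^ 2 = 1 → x = 1 ∨ x = -1 := fun x hx =>
      sq_eq_sq_iff_eq_or_eq_neg.1 (by rw [hx, one_pow])
    obtain ⟨a, ha, ha'⟩ := hstrict 1 (by norm_num)
    obtain ⟨b, hb, hb'⟩ := hstrict (-1) (by norm_num)
    rcases hsq a ha with rfl | rfl <;>
    rcases hsq b hb with rfl | rfl <;> nlinarith
  have key := neg_one_pow_sum_multiplicity_mul_pos hfin.toFinset H m hH.continuousOn
    (left_ne_zero_of_mul hprod.ne') (right_ne_zero_of_mul hprod.ne')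
    (fun z hz => by simp [hz.1, hz.2]) (fun z hz => (hfin.mem_toFinset.1 hz).1)
    (fun z hz => hm z (hfin.mem_toFinset.1 hz).1 (hfin.mem_toFinset.1 hz).2)
  by_contra hodd
  rw [Nat.not_even_iff_odd] at hodd
  rw [hodd.neg_one_pow] at key
  linarith
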